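/- Let $K$ be a field, let $n\ge 0$, and let $A_n(K)$ be the $n$-th Weyl algebra, i.e. the $K$-algebra generated by $x_1,\dots,x_n,y_1,\dots,y_n$ with the relations $x_ix_j=x_jx_i$, $y_iy_j=y_jy_i$, $y_ix_j-x_jy_i=\delta_{ij}$. A valuation on a skewfield $\Delta$ with values in a totally ordered abelian group $\Gamma$ is a map $w:\Delta\to\Gamma\cup\{\infty\}$ such that $w(a)=\infty$ if and only if $a=0$, $w(ab)=w(a)+w(b)$ and $w(a+b)\ge\min(w(a),w(b))$ for all $a,b\in\Delta$. Then $A_n(K)$ has a skewfield of fractions $D_n(K)$ (a skewfield containing $A_n(K)$ in which every element can be written as $s^{-1}a$ and as $bt^{-1}$ with $a,b,s,t\in A_n(K)$, $s,t\ne 0$; it is unique up to isomorphism over $A_n(K)$), and every valuation $v:K\to\Gamma\cup\{\infty\}$ extends to a valuation $w:D_n(K)\to\Gamma\cup\{\infty\}$ with the same $\Gamma$, i.e. $w(c)=v(c)$ for all $c\in K$. -/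

import Mathlib

universe u v w

/-- The defining relations of the `n`-th Weyl algebra, on the free algebra with generators
`x i = ι (Sum.inl i)` and `y i = ι (Sum.inr i)`, `i < n`:
the `x i` commute, the `y i` commute, and `y i * x j - x j * y i` is `1` if `i = j`, else `0`. -/
inductive WeylAlgebra.Rel (K : Type*) [CommRing K] (n : ℕ) :
    FreeAlgebra K (Fin n ⊕ Fin n) → FreeAlgebra K (Fin n ⊕ Fin n) → Prop
  | x_comm (i j : Fin n) : WeylAlgebra.Rel K n
      (FreeAlgebra.ι K (Sum.inl i) * FreeAlgebra.ι K (Sum.inl j))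
      (FreeAlgebra.ι K (Sum.inl j) * FreeAlgebra.ι K (Sum.inl i))
  | y_comm (i j : Fin n) : WeylAlgebra.Rel K n
      (FreeAlgebra.ι K (Sum.inr i) * FreeAlgebra.ι K (Sum.inr j))
      (FreeAlgebra.ι K (Sum.inr j) * FreeAlgebra.ι K (Sum.inr i))
  | y_x (i j : Fin n) : WeylAlgebra.Rel K n
      (FreeAlgebra.ι K (Sum.inr i) * FreeAlgebra.ι K (Sum.inl j))
      (FreeAlgebra.ι K (Sum.inl j) * FreeAlgebra.ι K (Sum.inr i) + if i = j then 1 else 0)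

/-- The `n`-th Weyl algebra `A_n(K)`, by generators and relations. -/
abbrev WeylAlgebra (K : Type*) [CommRing K] (n : ℕ) : Type _ :=
  RingQuot (WeylAlgebra.Rel K n)

/-- `ι : A → D` exhibits the skewfield `D` as the (classical, two-sided) skewfield of fractions
of `A`: `ι` is injective, and every element of `D` is both a left fraction `s⁻¹ a` and a right
fraction `a s⁻¹` with `a, s` in `A` and `s ≠ 0`. Such a `D` is unique up to unique
isomorphism over `A`. -/
structure IsSkewfieldOfFractions {A D : Type*} [Ring A] [DivisionRing D] (ι : A →+* D) :
    Prop where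
  injective : Function.Injective ι
  left_fraction : ∀ d : D, ∃ a s : A, s ≠ 0 ∧ d = (ι s)⁻¹ * ι a
  right_fraction : ∀ d : D, ∃ a s : A, s ≠ 0 ∧ d = ι a * (ι s)⁻¹

/-! The extension is a Gauss valuation. The monomials `x ^ α * y ^ β` form a basis, and the product
of two of them is the monomial with the summed exponents plus an integral combination of monomials
with smaller exponents (`basis_isTriangular`). Integers have value at most 1 in multiplicative
notation, so the maximum of the values of the coefficients is submultiplicative. It is
multiplicative because, among the coefficients of maximal value, those with the lexicographically
largest exponents multiply to a term that nothing can cancel (`gaussNorm_mul`). No new values arise,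
and only 0 has value zero, so the Weyl algebra is a domain.

The Ore conditions follow from polynomial growth: two nonzero one-sided ideals on the same side
meeting in 0 would force dimensions to double at regular steps
(`LinearMap.exists_apply_eq_apply_of_growth`). Ore localization then gives the skewfield, and `w
(s⁻¹ a) = w a / w s` extends the valuation to any skewfield of fractions. -/

open scoped TensorProduct

open scoped IsMulCommutative in
/-- Pairwise commuting elements of a noncommutative algebra receive a homomorphism from the
polynomial algebra. -/
theorem MvPolynomial.exists_algHom_of_commute {K σ A : Type*} [CommRing K] [Ring A] [Algebra K A]
    (f : σ → A) (hf : ∀ i j, f i * f j = f j * f i) :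
    ∃ g : MvPolynomial σ K →ₐ[K] A, ∀ i, g (MvPolynomial.X i) = f i := by
  have := Algebra.isMulCommutative_adjoin K (s := Set.range f)
    (by rintro _ ⟨i, rfl⟩ _ ⟨j, rfl⟩; exact hf i j)
  refine ⟨(Algebra.adjoin K (Set.range f)).val.comp
    (MvPolynomial.aeval (R := K) (S₁ := Algebra.adjoin K (Set.range f)) fun i ↦
      ⟨f i, Algebra.subset_adjoin ⟨i, rfl⟩⟩), fun i ↦ ?_⟩
  rw [AlgHom.comp_apply, MvPolynomial.aeval_X]
  rfl

/-! ### The monomial basis of the Weyl algebra. -/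

namespace WeylAlgebra

variable {K : Type*} [CommRing K] {n : ℕ}

/-- The generator `x i` of the Weyl algebra. -/
noncomputable def x (K : Type*) [CommRing K] {n : ℕ} (i : Fin n) : WeylAlgebra K n :=
  RingQuot.mkAlgHom K (Rel K n) (FreeAlgebra.ι K (Sum.inl i))

/-- The generator `y i` of the Weyl algebra. -/
noncomputable def y (K : Type*) [CommRing K] {n : ℕ} (i : Fin n) : WeylAlgebra K n :=
  RingQuot.mkAlgHom K (Rel K n) (FreeAlgebra.ι K (Sum.inr i))

theorem x_mul_x (i j : Fin n) : x K i * x K j = x K j * x K i := by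
  simp only [x, ← map_mul]
  exact RingQuot.mkAlgHom_rel K (Rel.x_comm (K := K) i j)

theorem y_mul_y (i j : Fin n) : y K i * y K j = y K j * y K i := by
  simp only [y, ← map_mul]
  exact RingQuot.mkAlgHom_rel K (Rel.y_comm (K := K) i j)

theorem y_mul_x (i j : Fin n) : y K i * x K j = x K j * y K i + if i = j then 1 else 0 := by
  have h := RingQuot.mkAlgHom_rel K (Rel.y_x (K := K) i j)
  simp only [x, y, ← map_mul]
  rw [h]
  split_ifs <;> simp

/-- The subalgebra of polynomials in the `x i`. -/
noncomputable def polyX (K : Type*) [CommRing K] (n : ℕ) :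
    MvPolynomial (Fin n) K →ₐ[K] WeylAlgebra K n :=
  (MvPolynomial.exists_algHom_of_commute (K := K) (x K) x_mul_x).choose

/-- The subalgebra of polynomials in the `y i`. -/
noncomputable def polyY (K : Type*) [CommRing K] (n : ℕ) :
    MvPolynomial (Fin n) K →ₐ[K] WeylAlgebra K n :=
  (MvPolynomial.exists_algHom_of_commute (K := K) (y K) y_mul_y).choose

@[simp]
theorem polyX_X (i : Fin n) : polyX K n (MvPolynomial.X i) = x K i :=
  (MvPolynomial.exists_algHom_of_commute (K := K) (x K) x_mul_x).choose_spec i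

@[simp]
theorem polyY_X (i : Fin n) : polyY K n (MvPolynomial.X i) = y K i :=
  (MvPolynomial.exists_algHom_of_commute (K := K) (y K) y_mul_y).choose_spec i

theorem y_mul_polyX (i : Fin n) (p : MvPolynomial (Fin n) K) :
    y K i * polyX K n p = polyX K n p * y K i + polyX K n (MvPolynomial.pderiv i p) := by
  induction p using MvPolynomial.induction_on with
  | C a =>
    rw [MvPolynomial.pderiv_C, map_zero, add_zero, MvPolynomial.C_eq_algebraMap]
    simp [Algebra.commutes]
  | add p q hp hq => simp only [map_add, mul_add, add_mul, hp, hq]; abel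
  | mul_X p j hp =>
    have h : polyX K n (MvPolynomial.pderiv i (MvPolynomial.X j)) = if i = j then 1 else 0 := by
      rw [MvPolynomial.pderiv_X, Pi.single_apply]
      by_cases hij : j = i
      · simp [hij]
      · simp [hij, Ne.symm hij]
    rw [Derivation.leibniz, map_mul, ← mul_assoc, hp, add_mul, mul_assoc, polyX_X, y_mul_x,
      map_add, smul_eq_mul, smul_eq_mul, map_mul, map_mul, h, polyX_X, mul_add, mul_assoc,
      add_assoc]
    congr 2
    rw [← polyX_X, ← map_mul, ← map_mul, mul_comm]

/-- The action of the generators of the Weyl algebra on normally ordered polynomials. -/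
noncomputable def genRep (K : Type*) [CommRing K] (n : ℕ) :
    Fin n ⊕ Fin n → Module.End K (MvPolynomial (Fin n) K ⊗[K] MvPolynomial (Fin n) K)
  | Sum.inl i => LinearMap.rTensor _ (LinearMap.mulLeft K (MvPolynomial.X i))
  | Sum.inr i => LinearMap.lTensor _ (LinearMap.mulLeft K (MvPolynomial.X i)) +
      LinearMap.rTensor _ (MvPolynomial.pderiv i).toLinearMap

/-- The commutator of two derivations is a derivation, and this one kills every variable. -/
theorem pderiv_comm {σ : Type*} (i j : σ) (p : MvPolynomial σ K) :
    MvPolynomial.pderiv i (MvPolynomial.pderiv j p) =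
      MvPolynomial.pderiv j (MvPolynomial.pderiv i p) := by
  classical
  have h : ⁅MvPolynomial.pderiv (R := K) i, MvPolynomial.pderiv (R := K) j⁆ = 0 := by
    apply MvPolynomial.derivation_ext
    intro k
    simp only [Derivation.commutator_apply, MvPolynomial.pderiv_X, Derivation.coe_zero,
      Pi.zero_apply, Pi.single_apply]
    split_ifs <;> simp
  have h2 := DFunLike.congr_fun h p
  simpa [Derivation.commutator_apply, sub_eq_zero] using h2

/-- The action of the Weyl algebra on normally ordered polynomials. -/
noncomputable def rep (K : Type*) [CommRing K] (n : ℕ) : WeylAlgebra K n →ₐ[K]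
    Module.End K (MvPolynomial (Fin n) K ⊗[K] MvPolynomial (Fin n) K) :=
  RingQuot.liftAlgHom K ⟨FreeAlgebra.lift K (genRep K n), by
    intro a b h
    induction h with
    | x_comm i j =>
      simp only [map_mul, FreeAlgebra.lift_ι_apply, genRep]
      apply TensorProduct.ext'
      intro p q
      simp [mul_left_comm]
    | y_comm i j =>
      simp only [map_mul, FreeAlgebra.lift_ι_apply, genRep]
      apply TensorProduct.ext'
      intro p q
      simp [mul_left_comm, pderiv_comm i j]
      abel
    | y_x i j =>
      simp only [map_mul, map_add, FreeAlgebra.lift_ι_apply, genRep]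
      apply TensorProduct.ext'
      intro p q
      have h : MvPolynomial.pderiv (R := K) i (MvPolynomial.X j) = if i = j then 1 else 0 := by
        rw [MvPolynomial.pderiv_X, Pi.single_apply]
        by_cases hij : j = i
        · simp [hij]
        · simp [hij, Ne.symm hij]
      by_cases hij : i = j
      · simp [hij, TensorProduct.add_tmul, add_assoc]
      · simp [h, hij]⟩

theorem rep_x (i : Fin n) : rep K n (x K i) = genRep K n (Sum.inl i) := by
  rw [rep, x, RingQuot.liftAlgHom_mkAlgHom_apply, FreeAlgebra.lift_ι_apply]

theorem rep_y (i : Fin n) : rep K n (y K i) = genRep K n (Sum.inr i) := by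
  rw [rep, y, RingQuot.liftAlgHom_mkAlgHom_apply, FreeAlgebra.lift_ι_apply]

/-- Normal ordering: `p ⊗ q` is sent to `p(x) q(y)`. -/
noncomputable def ofPoly (K : Type*) [CommRing K] (n : ℕ) :
    MvPolynomial (Fin n) K ⊗[K] MvPolynomial (Fin n) K →ₗ[K] WeylAlgebra K n :=
  LinearMap.mul' K _ ∘ₗ TensorProduct.map (polyX K n).toLinearMap (polyY K n).toLinearMap

@[simp]
theorem ofPoly_tmul (p q : MvPolynomial (Fin n) K) :
    ofPoly K n (p ⊗ₜ q) = polyX K n p * polyY K n q := rfl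

/-- The Weyl algebra is generated by the `x i` and `y i`. -/
theorem induction_on {P : WeylAlgebra K n → Prop} (a : WeylAlgebra K n)
    (hc : ∀ c, P (algebraMap K _ c)) (hx : ∀ i, P (x K i)) (hy : ∀ i, P (y K i))
    (hadd : ∀ a b, P a → P b → P (a + b)) (hmul : ∀ a b, P a → P b → P (a * b)) : P a := by
  obtain ⟨a, rfl⟩ := RingQuot.mkAlgHom_surjective K (Rel K n) a
  induction a using FreeAlgebra.induction with
  | grade0 c => simpa using hc c
  | grade1 i => exact i.rec hx hy
  | mul a b ha hb => simpa using hmul _ _ ha hb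
  | add a b ha hb => simpa using hadd _ _ ha hb

/-- Normal ordering intertwines `rep` with left multiplication. At `t = 1 ⊗ₜ 1` this gives
surjectivity of `ofPoly`. -/
theorem ofPoly_rep (a : WeylAlgebra K n) (t) : ofPoly K n (rep K n a t) = a * ofPoly K n t := by
  induction a using induction_on generalizing t with
  | hc c => simp [Algebra.smul_def, Module.algebraMap_end_apply]
  | hx i =>
    induction t with
    | zero => simp
    | add s t hs ht => simp only [map_add, hs, ht, mul_add]
    | tmul p q => simp [rep_x, genRep, mul_assoc]
  | hy i =>
    induction t with
    | zero => simp
    | add s t hs ht => simp only [map_add, hs, ht, mul_add]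
    | tmul p q =>
      simp [rep_y, genRep, ← mul_assoc, y_mul_polyX, add_mul]
  | hadd a b ha hb => simp [ha, hb, add_mul]
  | hmul a b ha hb => simp [ha, hb, mul_assoc]

theorem rep_polyX (p p' q : MvPolynomial (Fin n) K) :
    rep K n (polyX K n p) (p' ⊗ₜ q) = (p * p') ⊗ₜ q := by
  induction p using MvPolynomial.induction_on generalizing p' with
  | C a =>
    rw [MvPolynomial.C_eq_algebraMap, AlgHom.commutes, AlgHom.commutes,
      Module.algebraMap_end_apply, TensorProduct.smul_tmul', Algebra.smul_def]
  | add a b ha hb => simp [ha, hb, add_mul, TensorProduct.add_tmul]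
  | mul_X a j ha => simp [ha, rep_x, genRep, mul_assoc]

theorem rep_polyY (q q' : MvPolynomial (Fin n) K) :
    rep K n (polyY K n q) (1 ⊗ₜ q') = 1 ⊗ₜ (q * q') := by
  induction q using MvPolynomial.induction_on generalizing q' with
  | C a =>
    rw [MvPolynomial.C_eq_algebraMap, AlgHom.commutes, AlgHom.commutes,
      Module.algebraMap_end_apply, ← TensorProduct.tmul_smul, Algebra.smul_def]
  | add a b ha hb => simp [ha, hb, add_mul, TensorProduct.tmul_add]
  | mul_X a j ha => simp [ha, rep_y, genRep, mul_assoc]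

/-- Acting on `1 ⊗ₜ 1` recovers the normally ordered polynomial, so `ofPoly` is injective. Unlike
the action on polynomials in the `x i` alone, this works in every characteristic. -/
theorem rep_ofPoly (t) : rep K n (ofPoly K n t) (1 ⊗ₜ 1) = t := by
  induction t with
  | zero => simp
  | add s t hs ht => simp [hs, ht]
  | tmul p q => simp [rep_polyX, rep_polyY]

/-- The Poincaré-Birkhoff-Witt isomorphism of the Weyl algebra. -/
noncomputable def ofPolyEquiv (K : Type*) [CommRing K] (n : ℕ) :
    (MvPolynomial (Fin n) K ⊗[K] MvPolynomial (Fin n) K) ≃ₗ[K] WeylAlgebra K n :=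
  LinearEquiv.ofBijective (ofPoly K n)
    ⟨fun s t h ↦ by rw [← rep_ofPoly s, h, rep_ofPoly],
      fun a ↦ ⟨rep K n a (1 ⊗ₜ 1), by simp [ofPoly_rep]⟩⟩

/-- The basis `x ^ α * y ^ β` of the Weyl algebra. -/
noncomputable def basis (K : Type*) [CommRing K] (n : ℕ) :
    Module.Basis ((Fin n →₀ ℕ) × (Fin n →₀ ℕ)) K (WeylAlgebra K n) :=
  ((MvPolynomial.basisMonomials (Fin n) K).tensorProduct
    (MvPolynomial.basisMonomials (Fin n) K)).map (ofPolyEquiv K n)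

theorem basis_apply (α β : Fin n →₀ ℕ) : basis K n (α, β) =
    polyX K n (MvPolynomial.monomial α 1) * polyY K n (MvPolynomial.monomial β 1) := by
  simp [basis, ofPolyEquiv]
  rfl

end WeylAlgebra

/-! ### Bases that are multiplicative up to lower integral terms. -/

section Triangular

variable {K S A : Type*} [CommRing K] [Ring A] [Algebra K A] [PartialOrder S]

/-- The integral combinations of basis vectors of index below `u`. -/
def Module.Basis.lowerTerms (b : Module.Basis S K A) (u : S) : AddSubgroup A :=
  AddSubgroup.closure (b '' Set.Iio u)

namespace Module.Basis

variable {b : Module.Basis S K A}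

theorem mem_lowerTerms {s u : S} (h : s < u) : b s ∈ b.lowerTerms u :=
  AddSubgroup.subset_closure ⟨s, h, rfl⟩

theorem lowerTerms_mono {s u : S} (h : s ≤ u) : b.lowerTerms s ≤ b.lowerTerms u :=
  AddSubgroup.closure_mono (Set.image_mono (Set.Iio_subset_Iio h))

theorem repr_of_mem_lowerTerms {a : A} {u : S} (h : a ∈ b.lowerTerms u) (r : S) :
    (∃ z : ℤ, b.repr a r = z) ∧ (b.repr a r ≠ 0 → r < u) := by
  classical
  induction h using AddSubgroup.closure_induction with
  | mem a ha =>
    obtain ⟨s, hs, rfl⟩ := ha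
    rw [b.repr_self, Finsupp.single_apply]
    split_ifs with h
    · exact ⟨⟨1, by simp⟩, fun _ ↦ h ▸ hs⟩
    · exact ⟨⟨0, by simp⟩, fun h ↦ (h rfl).elim⟩
  | zero => exact ⟨⟨0, by simp⟩, by simp⟩
  | add a c _ _ ha hc =>
    obtain ⟨⟨z, hz⟩, ha⟩ := ha
    obtain ⟨⟨z', hz'⟩, hc⟩ := hc
    refine ⟨⟨z + z', by simp [hz, hz']⟩, fun h ↦ ?_⟩
    by_contra h'
    rw [map_add, Finsupp.add_apply, not_not.1 (mt ha h'), not_not.1 (mt hc h'), add_zero] at h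
    exact h rfl
  | neg a _ ha =>
    obtain ⟨⟨z, hz⟩, ha⟩ := ha
    exact ⟨⟨-z, by simp [hz]⟩, fun h ↦ ha fun h' ↦ h (by simp [h'])⟩

variable [AddCommMonoid S]

/-- `a` has leading term `b s`, and multiplies basis vectors accordingly. -/
def ActsAs (b : Module.Basis S K A) (a : A) (s : S) : Prop :=
  ∀ t, a * b t - b (s + t) ∈ b.lowerTerms (s + t)

/-- A basis indexed by an ordered monoid, multiplicative up to integral combinations of
lower basis vectors. -/
structure IsTriangular (b : Module.Basis S K A) : Prop where
  map_zero : b 0 = 1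
  actsAs : ∀ s, b.ActsAs (b s) s

theorem ActsAs.one : b.ActsAs 1 0 := fun t ↦ by simp [zero_mem]

theorem ActsAs.mul_mem [IsOrderedCancelAddMonoid S] {a : A} {s u : S} (h : b.ActsAs a s)
    {c : A} (hc : c ∈ b.lowerTerms u) :
    a * c ∈ b.lowerTerms (s + u) := by
  induction hc using AddSubgroup.closure_induction with
  | mem c hc =>
    obtain ⟨t, ht, rfl⟩ := hc
    have hlt : s + t < s + u := by simpa using ht
    rw [← sub_add_cancel (a * b t) (b (s + t))]
    exact add_mem (lowerTerms_mono hlt.le (h t)) (mem_lowerTerms hlt)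
  | zero => simp [zero_mem]
  | add c d _ _ hc hd => rw [mul_add]; exact add_mem hc hd
  | neg c _ hc => rw [mul_neg]; exact neg_mem hc

/-- Closure under products reduces triangularity of a basis to the factors of its elements. -/
theorem ActsAs.mul [IsOrderedCancelAddMonoid S] {a a' : A} {s s' : S}
    (h : b.ActsAs a s) (h' : b.ActsAs a' s') :
    b.ActsAs (a * a') (s + s') := fun t ↦ by
  have := add_mem (h.mul_mem (h' t)) (h (s' + t))
  rwa [mul_sub, sub_add_sub_cancel, ← mul_assoc, ← add_assoc] at this

namespace IsTriangular

variable (hb : b.IsTriangular)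
include hb

theorem repr_mul_eq_intCast (s t r : S) : ∃ z : ℤ, b.repr (b s * b t) r = z := by
  classical
  obtain ⟨⟨z, hz⟩, -⟩ := repr_of_mem_lowerTerms (hb.actsAs s t) r
  rw [map_sub, b.repr_self, Finsupp.sub_apply, Finsupp.single_apply] at hz
  refine ⟨z + if s + t = r then 1 else 0, ?_⟩
  rw [sub_eq_iff_eq_add.1 hz]
  split_ifs <;> simp

theorem repr_mul_add (s t : S) : b.repr (b s * b t) (s + t) = 1 := by
  obtain ⟨-, h⟩ := repr_of_mem_lowerTerms (hb.actsAs s t) (s + t)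
  have h := not_not.1 (mt h (lt_irrefl _))
  simpa [sub_eq_zero] using h

theorem le_of_repr_mul_ne_zero {s t r : S} (h : b.repr (b s * b t) r ≠ 0) : r ≤ s + t := by
  classical
  obtain ⟨-, h'⟩ := repr_of_mem_lowerTerms (hb.actsAs s t) r
  by_contra hr
  rw [map_sub, b.repr_self, Finsupp.sub_apply,
    Finsupp.single_eq_of_ne (fun h ↦ hr h.le), sub_zero] at h'
  exact hr (h' h).le

end IsTriangular

end Module.Basis

end Triangular

/-! ### Triangularity of the monomial basis. -/

namespace WeylAlgebra

variable {K : Type*} [CommRing K] {n : ℕ}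

open MvPolynomial in
theorem actsAs_polyX (α : Fin n →₀ ℕ) :
    (basis K n).ActsAs (polyX K n (monomial α 1)) (α, 0) := fun ⟨α', β⟩ ↦ by
  rw [Prod.mk_add_mk, zero_add, basis_apply, basis_apply, ← mul_assoc, ← map_mul, monomial_mul,
    one_mul, sub_self]
  exact zero_mem _

open MvPolynomial in
theorem actsAs_y (i : Fin n) :
    (basis K n).ActsAs (y K i) (0, Finsupp.single i 1) := fun ⟨α, β⟩ ↦ by
  have h : y K i * basis K n (α, β) - basis K n ((0, Finsupp.single i 1) + (α, β)) =
      α i • basis K n (α - Finsupp.single i 1, β) := by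
    rw [Prod.mk_add_mk, zero_add, basis_apply, basis_apply, basis_apply, ← mul_assoc, y_mul_polyX,
      add_mul, mul_assoc, ← polyY_X, ← map_mul, X, monomial_mul, one_mul, add_sub_cancel_left,
      pderiv_monomial, one_mul, ← smul_mul_assoc, ← map_nsmul, nsmul_eq_mul,
      ← map_natCast (C (σ := Fin n) (R := K)), C_mul_monomial, mul_one]
  rw [h]
  refine nsmul_mem (Module.Basis.mem_lowerTerms ?_) _
  -- Strictness comes from the second exponent, so truncated subtraction at `α i = 0` does no harm.
  refine Prod.mk_lt_mk.2 (Or.inr ⟨?_, ?_⟩)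
  · simp
  · exact lt_add_of_pos_left _ (by simp [pos_iff_ne_zero])

open MvPolynomial in
theorem actsAs_polyY (β : Fin n →₀ ℕ) :
    (basis K n).ActsAs (polyY K n (monomial β 1)) (0, β) := by
  induction β using Finsupp.induction_linear with
  | zero => simpa using! Module.Basis.ActsAs.one (b := basis K n)
  | add β β' h h' =>
    simpa only [← map_mul, monomial_mul, one_mul, Prod.mk_add_mk, add_zero] using h.mul h'
  | single i m =>
    induction m with
    | zero => simpa using! Module.Basis.ActsAs.one (b := basis K n)
    | succ m ih =>
      have h := ih.mul (actsAs_y i)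
      rw [← polyY_X, ← map_mul, X, monomial_mul, one_mul, Prod.mk_add_mk, add_zero,
        ← Finsupp.single_add] at h
      exact h

theorem basis_isTriangular (K : Type*) [CommRing K] (n : ℕ) : (basis K n).IsTriangular where
  map_zero := by
    rw [← Prod.mk_zero_zero, basis_apply]
    simp
  actsAs := fun ⟨α, β⟩ ↦ by
    rw [basis_apply]
    simpa using (actsAs_polyX α).mul (actsAs_polyY β)

end WeylAlgebra

/-! ### The Gauss extension of a valuation. -/

namespace Module.Basis

variable {K S A Γ₀ T : Type*} [Field K] [Ring A] [Algebra K A] [LinearOrderedCommGroupWithZero Γ₀]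
  [LinearOrder T]

theorem repr_mul_eq_sum (b : Module.Basis S K A) (a c : A) (r : S) :
    b.repr (a * c) r = ∑ p ∈ (b.repr a).support ×ˢ (b.repr c).support,
      b.repr a p.1 * b.repr c p.2 * b.repr (b p.1 * b p.2) r := by
  conv_lhs => rw [← b.linearCombination_repr a, ← b.linearCombination_repr c]
  rw [Finsupp.linearCombination_apply, Finsupp.linearCombination_apply, Finsupp.sum, Finsupp.sum,
    Finset.sum_mul_sum, ← Finset.sum_product', map_sum, Finsupp.finsetSum_apply]
  refine Finset.sum_congr rfl fun p _ ↦ ?_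
  rw [smul_mul_smul_comm, map_smul, Finsupp.smul_apply, smul_eq_mul]

/-- The maximum of the values of the coefficients. -/
noncomputable def gaussNorm (b : Module.Basis S K A) (v : Valuation K Γ₀) (a : A) : Γ₀ :=
  (b.repr a).support.sup fun s ↦ v (b.repr a s)

variable {b : Module.Basis S K A} {v : Valuation K Γ₀}

theorem gaussNorm_le_iff {a : A} {γ : Γ₀} :
    b.gaussNorm v a ≤ γ ↔ ∀ s, v (b.repr a s) ≤ γ := by
  rw [gaussNorm, Finset.sup_le_iff]
  refine forall_congr' fun s ↦ ⟨fun h ↦ ?_, fun h _ ↦ h⟩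
  by_cases hs : b.repr a s = 0
  · simp [hs]
  · exact h (Finsupp.mem_support_iff.2 hs)

theorem le_gaussNorm (a : A) (s : S) : v (b.repr a s) ≤ b.gaussNorm v a :=
  gaussNorm_le_iff.1 le_rfl s

theorem gaussNorm_eq_zero {a : A} (h : b.gaussNorm v a = 0) : a = 0 := by
  refine b.repr.map_eq_zero_iff.1 (Finsupp.ext fun s ↦ ?_)
  simpa [h] using le_gaussNorm (v := v) (b := b) a s

theorem gaussNorm_zero : b.gaussNorm v 0 = 0 := by
  simp [gaussNorm, bot_eq_zero]

theorem gaussNorm_smul_self (c : K) (s : S) : b.gaussNorm v (c • b s) = v c := by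
  classical
  refine le_antisymm (gaussNorm_le_iff.2 fun t ↦ ?_) ?_
  · rw [map_smul, b.repr_self, Finsupp.smul_apply, Finsupp.single_apply]
    split_ifs <;> simp
  · simpa using le_gaussNorm (v := v) (b := b) (c • b s) s

theorem gaussNorm_add_le (a c : A) :
    b.gaussNorm v (a + c) ≤ max (b.gaussNorm v a) (b.gaussNorm v c) :=
  gaussNorm_le_iff.2 fun s ↦ by
    rw [map_add, Finsupp.add_apply]
    exact (v.map_add _ _).trans (max_le_max (le_gaussNorm a s) (le_gaussNorm c s))

/-- Several coefficients may attain the maximal value; `e` breaks the tie. -/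
theorem exists_leading_index (e : S → T) {a : A} (ha : a ≠ 0) :
    ∃ s, v (b.repr a s) = b.gaussNorm v a ∧
      ∀ t, v (b.repr a t) = b.gaussNorm v a → e t ≤ e s := by
  have hne : (b.repr a).support.Nonempty := by simpa using ha
  obtain ⟨s, hs, h⟩ := Finset.exists_mem_eq_sup _ hne fun s ↦ v (b.repr a s)
  obtain ⟨s₀, hs₀, hmax⟩ := Finset.exists_max_image
    ((b.repr a).support.filter fun s ↦ v (b.repr a s) = b.gaussNorm v a) e
    ⟨s, Finset.mem_filter.2 ⟨hs, h.symm⟩⟩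
  refine ⟨s₀, (Finset.mem_filter.1 hs₀).2, fun t ht ↦ hmax t (Finset.mem_filter.2 ⟨?_, ht⟩)⟩
  refine Finsupp.mem_support_iff.2 fun h0 ↦ ha (gaussNorm_eq_zero (v := v) (b := b) ?_)
  rw [← ht, h0, map_zero]

theorem _root_.Valuation.map_intCast_le_one {R : Type*} [Ring R] (v : Valuation R Γ₀) (z : ℤ) :
    v z ≤ 1 :=
  intCast_mem v.integer z

namespace IsTriangular

variable [AddCommMonoid S] [PartialOrder S]
  [AddCommMonoid T] [IsOrderedCancelAddMonoid T]

variable (hb : b.IsTriangular)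
include hb

theorem map_repr_mul_le_one (v : Valuation K Γ₀) (s t r : S) : v (b.repr (b s * b t) r) ≤ 1 := by
  obtain ⟨z, hz⟩ := hb.repr_mul_eq_intCast s t r
  exact hz ▸ v.map_intCast_le_one z

theorem gaussNorm_mul_le (a c : A) :
    b.gaussNorm v (a * c) ≤ b.gaussNorm v a * b.gaussNorm v c :=
  gaussNorm_le_iff.2 fun r ↦ by
    rw [repr_mul_eq_sum]
    refine v.map_sum_le fun p _ ↦ ?_
    rw [map_mul, map_mul]
    exact (mul_le_of_le_one_right' (hb.map_repr_mul_le_one v _ _ _)).trans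
      (mul_le_mul' (le_gaussNorm a p.1) (le_gaussNorm c p.2))

theorem gaussNorm_mul (e : S →+ T) (he : StrictMono e) (hinj : Function.Injective e) (a c : A) :
    b.gaussNorm v (a * c) = b.gaussNorm v a * b.gaussNorm v c := by
  classical
  rcases eq_or_ne a 0 with rfl | ha
  · rw [zero_mul, gaussNorm_zero, zero_mul]
  rcases eq_or_ne c 0 with rfl | hc
  · rw [mul_zero, gaussNorm_zero, mul_zero]
  refine le_antisymm (hb.gaussNorm_mul_le a c) ?_
  obtain ⟨s, hs, hsmax⟩ := exists_leading_index (v := v) (b := b) e ha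
  obtain ⟨t, ht, htmax⟩ := exists_leading_index (v := v) (b := b) e hc
  have ha0 : b.gaussNorm v a ≠ 0 := mt gaussNorm_eq_zero ha
  have hc0 : b.gaussNorm v c ≠ 0 := mt gaussNorm_eq_zero hc
  have hmem : (s, t) ∈ (b.repr a).support ×ˢ (b.repr c).support := by
    rw [Finset.mem_product, Finsupp.mem_support_iff, Finsupp.mem_support_iff, ← v.ne_zero_iff,
      ← v.ne_zero_iff, hs, ht]
    exact ⟨ha0, hc0⟩
  -- All pairs other than the leading one contribute strictly less to the coefficient at `s + t`.
  have hlt : v (∑ p ∈ ((b.repr a).support ×ˢ (b.repr c).support).erase (s, t),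
      b.repr a p.1 * b.repr c p.2 * b.repr (b p.1 * b p.2) (s + t)) <
      b.gaussNorm v a * b.gaussNorm v c := by
    refine v.map_sum_lt (mul_ne_zero ha0 hc0) fun p hp ↦ ?_
    rw [map_mul, map_mul]
    by_cases h : v (b.repr a p.1) = b.gaussNorm v a ∧ v (b.repr c p.2) = b.gaussNorm v c
    -- If both coefficients have maximal value, a nonzero structure constant needs `s + t ≤ p.1 +
    -- p.2`, and maximality of `s` and `t` forces `p = (s, t)`.
    · suffices h0 : b.repr (b p.1 * b p.2) (s + t) = 0 by
        rw [h0, v.map_zero, mul_zero]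
        exact zero_lt_iff.2 (mul_ne_zero ha0 hc0)
      by_contra h0
      have h1 := he.monotone (hb.le_of_repr_mul_ne_zero h0)
      rw [map_add, map_add] at h1
      have h2 := hsmax _ h.1
      have h3 := htmax _ h.2
      have h4 : e p.1 = e s := h2.antisymm
        (le_of_add_le_add_right (h1.trans (add_le_add_right h3 _)))
      have h5 : e p.2 = e t := h3.antisymm
        (le_of_add_le_add_left (h1.trans (add_le_add_left h2 _)))
      exact (Finset.mem_erase.1 hp).1 (Prod.ext (hinj h4) (hinj h5))
    · refine (mul_le_of_le_one_right' (hb.map_repr_mul_le_one v _ _ _)).trans_lt ?_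
      rcases not_and_or.1 h with h | h
      · exact (mul_le_mul' le_rfl (le_gaussNorm _ _)).trans_lt
          (mul_lt_mul_of_pos_right ((le_gaussNorm _ _).lt_of_ne h) (zero_lt_iff.2 hc0))
      · exact (mul_le_mul' (le_gaussNorm _ _) le_rfl).trans_lt
          (mul_lt_mul_of_pos_left ((le_gaussNorm _ _).lt_of_ne h) (zero_lt_iff.2 ha0))
  refine le_trans (le_of_eq ?_) (le_gaussNorm (a * c) (s + t))
  rw [repr_mul_eq_sum, ← Finset.add_sum_erase _ _ hmem]
  dsimp only
  rw [hb.repr_mul_add, mul_one, v.map_add_eq_of_lt_left, map_mul, hs, ht]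
  rwa [map_mul, hs, ht]

/-- The Gauss extension of a valuation along a triangular basis. -/
noncomputable def gaussValuation (v : Valuation K Γ₀) (e : S →+ T) (he : StrictMono e)
    (hinj : Function.Injective e) : Valuation A Γ₀ where
  toFun := b.gaussNorm v
  map_zero' := gaussNorm_zero
  map_one' := by
    rw [← hb.map_zero, ← one_smul K (b 0), gaussNorm_smul_self, map_one]
  map_mul' := hb.gaussNorm_mul e he hinj
  map_add_le_max' := gaussNorm_add_le

theorem gaussValuation_algebraMap (e : S →+ T) (he : StrictMono e)
    (hinj : Function.Injective e) (c : K) :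
    hb.gaussValuation v e he hinj (algebraMap K A c) = v c := by
  rw [Algebra.algebraMap_eq_smul_one, ← hb.map_zero]
  exact gaussNorm_smul_self c 0

end IsTriangular

end Module.Basis

/-! ### The valuation on the Weyl algebra, and absence of zero divisors. -/

namespace WeylAlgebra

variable {K Γ₀ : Type*} [Field K] [LinearOrderedCommGroupWithZero Γ₀]

/-- The lexicographic order on the exponents of the monomials `x ^ α * y ^ β`. -/
def lexExponent (n : ℕ) :
    (Fin n →₀ ℕ) × (Fin n →₀ ℕ) →+ Lex (Lex (Fin n →₀ ℕ) × Lex (Fin n →₀ ℕ)) where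
  toFun s := toLex (toLex s.1, toLex s.2)
  map_zero' := rfl
  map_add' _ _ := rfl

theorem lexExponent_injective (n : ℕ) : Function.Injective (lexExponent n) :=
  fun _ _ h ↦ h

theorem lexExponent_strictMono (n : ℕ) : StrictMono (lexExponent n) :=
  Monotone.strictMono_of_injective
    (fun _ _ h ↦ Prod.Lex.toLex_mono ⟨Finsupp.toLex_monotone h.1, Finsupp.toLex_monotone h.2⟩)
    (lexExponent_injective n)

/-- A valuation of the base field extends to the Weyl algebra, with the same values. -/
theorem exists_valuation_extension (n : ℕ) (v : Valuation K Γ₀) :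
    ∃ w : Valuation (WeylAlgebra K n) Γ₀,
      (∀ c, w (algebraMap K _ c) = v c) ∧ ∀ a, w a = 0 → a = 0 :=
  ⟨(basis_isTriangular K n).gaussValuation v (lexExponent n) (lexExponent_strictMono n)
    (lexExponent_injective n), (basis_isTriangular K n).gaussValuation_algebraMap _ _ _,
    fun _ ↦ Module.Basis.gaussNorm_eq_zero⟩

instance (n : ℕ) : Nontrivial (WeylAlgebra K n) :=
  ⟨basis K n 0, 0, (basis K n).ne_zero 0⟩

instance (n : ℕ) : NoZeroDivisors (WeylAlgebra K n) where
  eq_zero_or_eq_zero_of_mul_eq_zero {a c} h := by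
    classical
    -- The trivial valuation exists on every field, and its extension is multiplicative and vanishes
    -- only at 0.
    obtain ⟨w, -, hw⟩ := exists_valuation_extension n (1 : Valuation K (WithZero (Multiplicative ℤ)))
    have h' := w.map_mul a c
    rw [h, map_zero, eq_comm, mul_eq_zero] at h'
    exact h'.imp (hw a) (hw c)

end WeylAlgebra

/-! ### The Ore conditions from polynomial growth. -/

/-- Two injective endomorphisms of an algebra that raise the level of an exhaustive filtration of
subexponential dimension by a bounded amount have images that meet nontrivially. -/
theorem LinearMap.exists_apply_eq_apply_of_growth {K A : Type*} [Field K] [AddCommGroup A]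
    [Module K A] (V : ℕ → Submodule K A) [∀ m, FiniteDimensional K (V m)] (hV0 : V 0 ≠ ⊥)
    {k : ℕ} (hgrowth : ∀ m, Module.finrank K (V m) ≤ (m + 1) ^ k) {d : ℕ} {f g : A →ₗ[K] A}
    (hf : Function.Injective f) (hg : Function.Injective g)
    (hfV : ∀ m, (V m).map f ≤ V (m + d)) (hgV : ∀ m, (V m).map g ≤ V (m + d)) :
    ∃ x y, f x = g y ∧ f x ≠ 0 := by
  by_contra! h
  have hdouble (m : ℕ) : 2 * Module.finrank K (V m) ≤ Module.finrank K (V (m + d)) := by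
    have hdisj : (V m).map f ⊓ (V m).map g = ⊥ := by
      rw [eq_bot_iff]
      rintro _ ⟨⟨x, -, rfl⟩, ⟨y, -, hy⟩⟩
      exact h x y hy.symm
    have h1 := Submodule.finrank_sup_add_finrank_inf_eq ((V m).map f) ((V m).map g)
    rw [hdisj, finrank_bot, add_zero, ← (Submodule.equivMapOfInjective f hf (V m)).finrank_eq,
      ← (Submodule.equivMapOfInjective g hg (V m)).finrank_eq, ← two_mul] at h1
    rw [← h1]
    exact Submodule.finrank_mono (sup_le (hfV m) (hgV m))
  have hpow (j : ℕ) : 2 ^ j ≤ Module.finrank K (V (j * d)) := by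
    induction j with
    | zero =>
      rw [zero_mul, pow_zero]
      have := Submodule.nontrivial_iff_ne_bot.2 hV0
      exact Module.finrank_pos
    | succ j ih =>
      rw [pow_succ', add_one_mul j d]
      exact (Nat.mul_le_mul_left 2 ih).trans (hdouble _)
  have hle (j : ℕ) : 2 ^ j ≤ (j * d + 1) ^ k := (hpow j).trans (hgrowth _)
  -- For `j ≥ 1`, `j * d + 1 ≤ j * (d + 1)`, so the contradiction needs `j ^ k / 2 ^ j` below this
  -- constant.
  have hpos : (0 : ℝ) < ((d + 1 : ℝ) ^ k)⁻¹ := by positivity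
  have hlim := tendsto_pow_const_div_const_pow_of_one_lt k (one_lt_two (α := ℝ))
  obtain ⟨j, hj, hj1⟩ := ((hlim.eventually_lt_const
    hpos).and (Filter.eventually_ge_atTop 1)).exists
  rw [div_lt_iff₀ (by positivity), inv_mul_eq_div, lt_div_iff₀ (by positivity), ← mul_pow] at hj
  have hj2 : j * d + 1 ≤ j * (d + 1) := by rw [mul_add, mul_one]; exact Nat.add_le_add_left hj1 _
  have hj3 : ((2 ^ j : ℕ) : ℝ) ≤ ((j * (d + 1)) ^ k : ℕ) :=
    Nat.cast_le.2 ((hle j).trans (Nat.pow_le_pow_left hj2 k))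
  push_cast at hj3
  exact hj3.not_gt hj

namespace WeylAlgebra

variable {K : Type*} [Field K] {n : ℕ}

/-- The exponents of the monomials `x ^ α * y ^ β` that are at most `m`. -/
def boxIndex (n m : ℕ) : Set ((Fin n →₀ ℕ) × (Fin n →₀ ℕ)) :=
  {s | ∀ i, s.1 i ≤ m ∧ s.2 i ≤ m}

/-- The span of the monomials `x ^ α * y ^ β` whose exponents are at most `m`. -/
noncomputable def box (K : Type*) [Field K] (n m : ℕ) : Submodule K (WeylAlgebra K n) :=
  Submodule.span K (basis K n '' boxIndex n m)

theorem boxIndex_eq_range (n m : ℕ) : boxIndex n m =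
    Set.range fun f : (Fin n → Fin (m + 1)) × (Fin n → Fin (m + 1)) ↦
      (Finsupp.equivFunOnFinite.symm fun i ↦ (f.1 i : ℕ),
        Finsupp.equivFunOnFinite.symm fun i ↦ (f.2 i : ℕ)) := by
  ext s
  constructor
  · exact fun h ↦ ⟨(fun i ↦ ⟨s.1 i, Nat.lt_succ_of_le (h i).1⟩,
      fun i ↦ ⟨s.2 i, Nat.lt_succ_of_le (h i).2⟩), by ext <;> rfl⟩
  · rintro ⟨f, rfl⟩ i
    exact ⟨Nat.le_of_lt_succ (f.1 i).2, Nat.le_of_lt_succ (f.2 i).2⟩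

theorem mem_box {m : ℕ} {a : WeylAlgebra K n} :
    a ∈ box K n m ↔ ∀ s, (basis K n).repr a s ≠ 0 → s ∈ boxIndex n m := by
  rw [box, Module.Basis.mem_span_image]
  exact forall_congr' fun s ↦ by rw [Finset.mem_coe, Finsupp.mem_support_iff]

/-- Triangularity holds for the componentwise order, so each exponent is bounded separately. -/
theorem mul_mem_box {a c : WeylAlgebra K n} {m d : ℕ} (ha : a ∈ box K n m) (hc : c ∈ box K n d) :
    a * c ∈ box K n (m + d) := by
  rw [mem_box] at *
  intro r hr i
  rw [Module.Basis.repr_mul_eq_sum] at hr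
  obtain ⟨p, hp, hpr⟩ := Finset.exists_ne_zero_of_sum_ne_zero hr
  rw [Finset.mem_product, Finsupp.mem_support_iff, Finsupp.mem_support_iff] at hp
  have hle := (basis_isTriangular K n).le_of_repr_mul_ne_zero (right_ne_zero_of_mul hpr)
  exact ⟨(hle.1 i).trans (add_le_add (ha _ hp.1 i).1 (hc _ hp.2 i).1),
    (hle.2 i).trans (add_le_add (ha _ hp.1 i).2 (hc _ hp.2 i).2)⟩

theorem box_mono : Monotone (box K n) := fun _ _ h ↦
  Submodule.span_mono (Set.image_mono fun _ hs i ↦ ⟨(hs i).1.trans h, (hs i).2.trans h⟩)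

theorem exists_mem_box (a : WeylAlgebra K n) : ∃ m, a ∈ box K n m := by
  refine ⟨(basis K n).repr a |>.support.sup fun s ↦ s.1.degree + s.2.degree, mem_box.2 ?_⟩
  intro s hs i
  have h := Finset.le_sup (f := fun s : (Fin n →₀ ℕ) × (Fin n →₀ ℕ) ↦ s.1.degree + s.2.degree)
    (Finsupp.mem_support_iff.2 hs)
  have h1 := Finsupp.le_degree i s.1
  have h2 := Finsupp.le_degree i s.2
  omega

instance (m : ℕ) : FiniteDimensional K (box K n m) :=
  FiniteDimensional.span_of_finite K (by
    rw [boxIndex_eq_range]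
    exact (Set.finite_range _).image _)

theorem finrank_box_le (m : ℕ) : Module.finrank K (box K n m) ≤ (m + 1) ^ (n + n) := by
  rw [box, boxIndex_eq_range, ← Set.range_comp]
  refine (finrank_range_le_card _).trans (le_of_eq ?_)
  simp [pow_add]

theorem box_zero_ne_bot : box K n 0 ≠ ⊥ := by
  refine Submodule.ne_bot_iff _ |>.2 ⟨basis K n 0, ?_, (basis K n).ne_zero 0⟩
  exact Submodule.subset_span ⟨0, fun _ ↦ ⟨le_rfl, le_rfl⟩, rfl⟩

theorem exists_mul_eq_mul_left {a c : WeylAlgebra K n} (ha : a ≠ 0) (hc : c ≠ 0) :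
    ∃ p q, p * a = q * c ∧ p * a ≠ 0 := by
  obtain ⟨d, hd⟩ := exists_mem_box a
  obtain ⟨d', hd'⟩ := exists_mem_box c
  refine LinearMap.exists_apply_eq_apply_of_growth (box K n) box_zero_ne_bot finrank_box_le
    (d := max d d') (f := LinearMap.mulRight K a) (g := LinearMap.mulRight K c)
    (mul_left_injective₀ ha) (mul_left_injective₀ hc) (fun m ↦ ?_) (fun m ↦ ?_)
  · rintro _ ⟨p, hp, rfl⟩
    exact mul_mem_box hp (box_mono (le_max_left _ _) hd)
  · rintro _ ⟨p, hp, rfl⟩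
    exact mul_mem_box hp (box_mono (le_max_right _ _) hd')

theorem exists_mul_eq_mul_right {a c : WeylAlgebra K n} (ha : a ≠ 0) (hc : c ≠ 0) :
    ∃ p q, a * p = c * q ∧ a * p ≠ 0 := by
  obtain ⟨d, hd⟩ := exists_mem_box a
  obtain ⟨d', hd'⟩ := exists_mem_box c
  refine LinearMap.exists_apply_eq_apply_of_growth (box K n) box_zero_ne_bot finrank_box_le
    (d := max d d') (f := LinearMap.mulLeft K a) (g := LinearMap.mulLeft K c)
    (mul_right_injective₀ ha) (mul_right_injective₀ hc) (fun m ↦ ?_) (fun m ↦ ?_)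
  · rintro _ ⟨p, hp, rfl⟩
    rw [add_comm]
    exact mul_mem_box (box_mono (le_max_left _ _) hd) hp
  · rintro _ ⟨p, hp, rfl⟩
    rw [add_comm]
    exact mul_mem_box (box_mono (le_max_right _ _) hd') hp

end WeylAlgebra

/-! ### The skewfield of fractions by Ore localization. -/

/-- A domain with the left and right Ore conditions has a skewfield of fractions. -/
theorem exists_isSkewfieldOfFractions {A : Type u} [Ring A] [Nontrivial A] [NoZeroDivisors A]
    (hl : ∀ a c : A, a ≠ 0 → c ≠ 0 → ∃ p q, p * a = q * c ∧ p * a ≠ 0)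
    (hr : ∀ a c : A, a ≠ 0 → c ≠ 0 → ∃ p q, a * p = c * q ∧ a * p ≠ 0) :
    ∃ (D : Type u) (_ : DivisionRing D) (ι : A →+* D), IsSkewfieldOfFractions ι := by
  have hOre (r : A) (s : nonZeroDivisors A) :
      ∃ p : A × nonZeroDivisors A, (p.2 : A) * r = p.1 * s := by
    rcases eq_or_ne r 0 with rfl | h
    · exact ⟨(0, 1), by simp⟩
    obtain ⟨p, q, h1, h2⟩ := hl r s h (nonZeroDivisors.coe_ne_zero s)
    exact ⟨(q, ⟨p, mem_nonZeroDivisors_of_ne_zero (left_ne_zero_of_mul h2)⟩), h1⟩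
  choose F hF using hOre
  let : OreLocalization.OreSet (nonZeroDivisors A) :=
    OreLocalization.oreSetOfNoZeroDivisors (fun r s ↦ (F r s).1) (fun r s ↦ (F r s).2) hF
  have hinj : Function.Injective
      (OreLocalization.numeratorRingHom (R := A) (S := nonZeroDivisors A)) :=
    OreLocalization.numeratorHom_inj inf_le_left
  have hfrac (d : OreLocalization (nonZeroDivisors A) A) : ∃ a s : A, s ≠ 0 ∧
      d = (OreLocalization.numeratorRingHom (S := nonZeroDivisors A) s)⁻¹ *
        OreLocalization.numeratorRingHom a := by
    induction d using OreLocalization.ind with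
    | _ r s =>
      refine ⟨r, s, nonZeroDivisors.coe_ne_zero s, ?_⟩
      rw [eq_inv_mul_iff_mul_eq₀]
      · exact OreLocalization.smul_cancel
      · exact (map_ne_zero_iff _ hinj).2 (nonZeroDivisors.coe_ne_zero s)
  refine ⟨OreLocalization (nonZeroDivisors A) A, inferInstance,
    OreLocalization.numeratorRingHom, hinj, hfrac, fun d ↦ ?_⟩
  obtain ⟨a, s, hs, rfl⟩ := hfrac d
  rcases eq_or_ne a 0 with rfl | ha
  · exact ⟨0, 1, one_ne_zero, by simp⟩
  -- From `a p = s q` follows `s⁻¹ a = q p⁻¹`.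
  obtain ⟨p, q, h1, h2⟩ := hr a s ha hs
  refine ⟨q, p, right_ne_zero_of_mul h2, ?_⟩
  rw [eq_mul_inv_iff_mul_eq₀ ((map_ne_zero_iff _ hinj).2 (right_ne_zero_of_mul h2)), mul_assoc,
    inv_mul_eq_iff_eq_mul₀ ((map_ne_zero_iff _ hinj).2 hs), ← map_mul, ← map_mul, h1]

/-! ### Extending a valuation to the skewfield of fractions. -/

namespace IsSkewfieldOfFractions

variable {A D Γ₀ : Type*} [Ring A] [DivisionRing D] [LinearOrderedCommGroupWithZero Γ₀]
  {ι : A →+* D}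

theorem map_ne_zero (h : IsSkewfieldOfFractions ι) {a : A} (ha : a ≠ 0) : ι a ≠ 0 :=
  (map_ne_zero_iff ι h.injective).2 ha

/-- Left fractions over a common denominator. -/
theorem exists_mul_eq_mul (h : IsSkewfieldOfFractions ι) (a : A) {s : A} (hs : s ≠ 0) :
    ∃ p q, p ≠ 0 ∧ p * a = q * s := by
  -- The left Ore condition is recovered by rewriting a right fraction as a left one.
  obtain ⟨q, p, hp, hd⟩ := h.left_fraction (ι a * (ι s)⁻¹)
  refine ⟨p, q, hp, h.injective ?_⟩
  rw [eq_inv_mul_iff_mul_eq₀ (h.map_ne_zero hp), ← mul_assoc,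
    mul_inv_eq_iff_eq_mul₀ (h.map_ne_zero hs)] at hd
  rw [map_mul, map_mul, hd]

variable {w : Valuation A Γ₀}

/-- Bringing both fractions to a common denominator `p s = q s'` makes the numerators `p a` and `q
a'` equal; the factors cancel in the commutative value group. -/
theorem map_div_eq_of_eq (h : IsSkewfieldOfFractions ι) (hw : ∀ a, w a = 0 → a = 0) {a s a' s' : A}
    (hs : s ≠ 0) (hs' : s' ≠ 0) (heq : (ι s)⁻¹ * ι a = (ι s')⁻¹ * ι a') :
    w a / w s = w a' / w s' := by
  obtain ⟨p, q, hp, hpq⟩ := h.exists_mul_eq_mul s hs'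
  have hpa : p * a = q * a' := h.injective <| by
    have h1 : ι a = ι s * ((ι s')⁻¹ * ι a') := by
      rw [← heq, mul_inv_cancel_left₀ (h.map_ne_zero hs)]
    rw [map_mul, h1, ← mul_assoc, ← map_mul, hpq, map_mul, map_mul, mul_assoc,
      mul_inv_cancel_left₀ (h.map_ne_zero hs')]
  have h1 := congrArg w hpq
  have h2 := congrArg w hpa
  rw [map_mul, map_mul] at h1 h2
  have hp0 := mt (hw p) hp
  rw [← mul_div_mul_left (w a) (w s) hp0, h1, h2, mul_div_mul_left]
  rintro hq
  rw [hq, zero_mul] at h1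
  exact mul_ne_zero hp0 (mt (hw s) hs) h1

/-- A valuation that vanishes only at zero extends to the skewfield of fractions. -/
theorem exists_valuation_extension (h : IsSkewfieldOfFractions ι) (hw : ∀ a, w a = 0 → a = 0) :
    ∃ W : Valuation D Γ₀, ∀ a, W (ι a) = w a := by
  choose num den hden hfrac using h.left_fraction
  have key {d : D} {a s : A} (hs : s ≠ 0) (hd : d = (ι s)⁻¹ * ι a) :
      w (num d) / w (den d) = w a / w s :=
    h.map_div_eq_of_eq hw (hden d) hs ((hfrac d).symm.trans hd)
  have hι (a : A) : w (num (ι a)) / w (den (ι a)) = w a := by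
    have := ι.domain_nontrivial
    rw [key (a := a) (s := 1) one_ne_zero (by simp), map_one, div_one]
  have hmul {a c : A} (ha : a ≠ 0) (hc : c ≠ 0) : a * c ≠ 0 := fun h0 ↦
    mul_ne_zero (mt (hw a) ha) (mt (hw c) hc) (by rw [← map_mul, h0, map_zero])
  refine ⟨⟨⟨⟨fun d ↦ w (num d) / w (den d), ?_⟩, ?_, fun d d' ↦ ?_⟩, fun d d' ↦ ?_⟩, hι⟩
  · simpa using hι 0
  · simpa using hι 1
  -- With `d = s⁻¹ a`, `d' = s'⁻¹ a'` and `p a = q s'`, the product is `(p s)⁻¹ (q a')`.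
  · obtain ⟨p, q, hp, hpq⟩ := h.exists_mul_eq_mul (num d) (hden d')
    have h1 : d * d' = (ι (p * den d))⁻¹ * ι (q * num d') := by
      have h2 : ι p * ι (num d) * (ι (den d'))⁻¹ = ι q := by
        rw [mul_inv_eq_iff_eq_mul₀ (h.map_ne_zero (hden d')), ← map_mul, ← map_mul, hpq]
      rw [map_mul, map_mul, ← h2, mul_inv_rev, mul_assoc, mul_assoc, mul_assoc,
        inv_mul_cancel_left₀ (h.map_ne_zero hp), ← hfrac d', ← mul_assoc, ← hfrac d]
    have h3 := congrArg w hpq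
    rw [map_mul, map_mul] at h3
    change w _ / w _ = w _ / w _ * (w _ / w _)
    rw [key (hmul hp (hden d)) h1, map_mul, map_mul, div_mul_div_comm,
      div_eq_div_iff (mul_ne_zero (mt (hw _) hp) (mt (hw _) (hden d)))
        (mul_ne_zero (mt (hw _) (hden d)) (mt (hw _) (hden d')))]
    calc w q * w (num d') * (w (den d) * w (den d'))
        = w q * w (den d') * (w (num d') * w (den d)) := by ac_rfl
      _ = _ := by rw [← h3]; ac_rfl
  · obtain ⟨p, q, hp, hpq⟩ := h.exists_mul_eq_mul (den d) (hden d')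
    have hpd := hmul hp (hden d)
    have hq : q ≠ 0 := fun h0 ↦ hpd (by rw [hpq, h0, zero_mul])
    have hcommon {d : D} {p : A} (hp : p ≠ 0) : d = (ι (p * den d))⁻¹ * ι (p * num d) := by
      rw [map_mul, map_mul, mul_inv_rev, mul_assoc, inv_mul_cancel_left₀ (h.map_ne_zero hp),
        ← hfrac d]
    have h1 := hcommon (d := d) hp
    have h2 := hcommon (d := d') hq
    rw [← hpq] at h2
    have h3 : d + d' = (ι (p * den d))⁻¹ * ι (p * num d + q * num d') := by
      rw [map_add, mul_add, ← h1, ← h2]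
    change w _ / w _ ≤ max (w _ / w _) (w _ / w _)
    rw [key hpd h3, key hpd h1, key hpd h2]
    rcases le_max_iff.1 (w.map_add (p * num d) (q * num d')) with h4 | h4
    · exact le_max_of_le_left (div_le_div_of_nonneg_right h4 zero_le)
    · exact le_max_of_le_right (div_le_div_of_nonneg_right h4 zero_le)

end IsSkewfieldOfFractions

theorem mainTheorem2 {K : Type u} [Field K] (n : ℕ)
    {Γ : Type v} [AddCommGroup Γ] [LinearOrder Γ] [IsOrderedAddMonoid Γ]
    (v : AddValuation K (WithTop Γ)) :
    (∃ (D : Type u) (_ : DivisionRing D) (ι : WeylAlgebra K n →+* D),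
      IsSkewfieldOfFractions ι) ∧
    ∀ (D : Type w) [DivisionRing D] (ι : WeylAlgebra K n →+* D),
      IsSkewfieldOfFractions ι →
        ∃ vD : AddValuation D (WithTop Γ),
          ∀ c : K, vD (ι (algebraMap K (WeylAlgebra K n) c)) = v c := by
  refine ⟨exists_isSkewfieldOfFractions (fun _ _ ↦ WeylAlgebra.exists_mul_eq_mul_left)
    fun _ _ ↦ WeylAlgebra.exists_mul_eq_mul_right, fun D _ ι h ↦ ?_⟩
  -- Reversing the order and writing the group multiplicatively turns `∞` into 0 and min into max.
  obtain ⟨w, hwv, hw⟩ := WeylAlgebra.exists_valuation_extension n (AddValuation.toValuation v)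
  obtain ⟨W, hW⟩ := h.exists_valuation_extension hw
  exact ⟨AddValuation.ofValuation W, fun c ↦ (hW _).trans (hwv c)⟩
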